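/- Let $\mathrm{Sch}$ be the category of schemes of finite type over $\mathbb{Q}$ (with morphisms of $\mathbb{Q}$-schemes), and let $\mathrm{Id}\colon \mathrm{Sch}\to\mathrm{Sch}$ be its identity functor. The only natural transformation $\mathrm{Id}\to\mathrm{Id}$ is the identity natural transformation. -/

import Mathlib

open CategoryTheory AlgebraicGeometry

/-- A `ℚ`-scheme (an object of the category of schemes over `Spec ℚ`) is of finite type if its
structure morphism is of finite type, i.e. locally of finite type and quasi-compact. -/
def IsFiniteTypeOverQ : ObjectProperty (Over (Spec (CommRingCat.of ℚ))) :=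
  fun X => LocallyOfFiniteType X.hom ∧ QuasiCompact X.hom

/-- The category of schemes of finite type over `ℚ`: the full subcategory of the category of
schemes over `Spec ℚ` on the objects of finite type. -/
abbrev SchQ : Type 1 := IsFiniteTypeOverQ.FullSubcategory

open Polynomial

/-! An element of a `ℚ`-algebra `R` is a map `ℚ[X] → R`, so by naturality `η` on `Spec R` is
governed by the image of `X` on the affine line (`ringEnd_eq_id`). Naturality at rational points
forces that polynomial to be `X` (`ringEnd_affineLine_X`). Affine opens then settle the general
case. -/

instance Rat.subsingleton_hom_of (R : CommRingCat) : Subsingleton (CommRingCat.of ℚ ⟶ R) :=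
  ⟨fun f g => CommRingCat.hom_ext (RingHom.ext_rat f.hom g.hom)⟩

instance Rat.subsingleton_hom_Spec (R : CommRingCat) :
    Subsingleton (Spec R ⟶ Spec (CommRingCat.of ℚ)) :=
  ⟨fun _ _ => Spec.homEquiv.injective (Subsingleton.elim _ _)⟩

namespace SchQ

/-- A `ℚ`-scheme of finite type with underlying scheme the spectrum of a given ring. -/
noncomputable def ofSpec {R : CommRingCat.{0}} (f : Spec R ⟶ Spec (CommRingCat.of ℚ))
    [LocallyOfFiniteType f] : SchQ :=
  ⟨Over.mk f, ‹_›, (inferInstance : QuasiCompact f)⟩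

/-- Every morphism between spectra over `ℚ` is a morphism of `ℚ`-schemes. -/
noncomputable def homOfSpec {R S : CommRingCat.{0}} (f : Spec R ⟶ Spec (CommRingCat.of ℚ))
    (g : Spec S ⟶ Spec (CommRingCat.of ℚ)) [LocallyOfFiniteType f] [LocallyOfFiniteType g]
    (φ : S ⟶ R) : ofSpec f ⟶ ofSpec g :=
  ObjectProperty.homMk (Over.homMk (Spec.map φ)
    (Subsingleton.elim (Spec.map φ ≫ g : Spec R ⟶ Spec (CommRingCat.of ℚ)) f))

/-- The endomorphism of the ring `R` induced by an endomorphism of the identity functor. -/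
noncomputable def ringEnd (η : 𝟭 SchQ ⟶ 𝟭 SchQ) {R : CommRingCat.{0}}
    (f : Spec R ⟶ Spec (CommRingCat.of ℚ)) [LocallyOfFiniteType f] : R ⟶ R :=
  Spec.preimage (η.app (ofSpec f)).hom.left

lemma map_ringEnd (η : 𝟭 SchQ ⟶ 𝟭 SchQ) {R : CommRingCat.{0}}
    (f : Spec R ⟶ Spec (CommRingCat.of ℚ)) [LocallyOfFiniteType f] :
    Spec.map (ringEnd η f) = (η.app (ofSpec f)).hom.left :=
  Spec.map_preimage _

lemma ringEnd_naturality (η : 𝟭 SchQ ⟶ 𝟭 SchQ) {R S : CommRingCat.{0}}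
    (f : Spec R ⟶ Spec (CommRingCat.of ℚ)) (g : Spec S ⟶ Spec (CommRingCat.of ℚ))
    [LocallyOfFiniteType f] [LocallyOfFiniteType g] (φ : S ⟶ R) :
    φ ≫ ringEnd η f = ringEnd η g ≫ φ := by
  apply Spec.map_injective
  rw [Spec.map_comp, Spec.map_comp, map_ringEnd, map_ringEnd]
  exact (congr_arg (fun h => h.hom.left) (η.naturality (homOfSpec f g φ))).symm

/-- The structure morphism of the affine line over `ℚ`. -/
noncomputable abbrev affineLine :
    Spec (CommRingCat.of ℚ[X]) ⟶ Spec (CommRingCat.of ℚ) :=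
  Spec.map (CommRingCat.ofHom C)

instance : LocallyOfFiniteType affineLine := by
  rw [HasRingHomProperty.Spec_iff (P := @LocallyOfFiniteType)]
  exact (RingHom.finiteType_algebraMap (A := ℚ) (B := ℚ[X])).2 inferInstance

lemma ringEnd_affineLine_X (η : 𝟭 SchQ ⟶ 𝟭 SchQ) :
    (ringEnd η affineLine).hom (X : ℚ[X]) = X := by
  -- Since `ℚ` is infinite, it suffices to compare values at rational points.
  refine Polynomial.funext fun c => ?_
  have h := ringEnd_naturality η (𝟙 (Spec (CommRingCat.of ℚ))) affineLine
    (CommRingCat.ofHom (evalRingHom c))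
  rw [Subsingleton.elim (ringEnd η (𝟙 (Spec (CommRingCat.of ℚ)))) (𝟙 _), Category.comp_id] at h
  exact (congr_arg (fun k => k.hom (X : ℚ[X])) h).symm

lemma ringEnd_eq_id (η : 𝟭 SchQ ⟶ 𝟭 SchQ) {R : CommRingCat.{0}}
    (f : Spec R ⟶ Spec (CommRingCat.of ℚ)) [LocallyOfFiniteType f] : ringEnd η f = 𝟙 R := by
  ext a
  have h := congr_arg (fun k => k.hom (X : ℚ[X])) (ringEnd_naturality η f affineLine
    (CommRingCat.ofHom (eval₂RingHom (Spec.preimage f).hom a)))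
  have hX : eval₂ (Spec.preimage f).hom a ((ringEnd η affineLine).hom (X : ℚ[X])) = a :=
    (congr_arg (eval₂ (Spec.preimage f).hom a) (ringEnd_affineLine_X η)).trans (eval₂_X _ _)
  exact (by simpa using h : (ringEnd η f).hom a = _).trans hX

lemma app_ofSpec (η : 𝟭 SchQ ⟶ 𝟭 SchQ) {R : CommRingCat.{0}}
    (f : Spec R ⟶ Spec (CommRingCat.of ℚ)) [LocallyOfFiniteType f] :
    (η.app (ofSpec f)).hom.left = 𝟙 (Spec R) := by
  rw [← map_ringEnd, ringEnd_eq_id, Spec.map_id]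

/-- An affine open of `Y` is itself of finite type over `ℚ`, so naturality applies to its inclusion.
-/
lemma comp_app_of_isOpenImmersion (η : 𝟭 SchQ ⟶ 𝟭 SchQ) (Y : SchQ) {R : CommRingCat.{0}}
    (j : Spec R ⟶ Y.obj.left) [IsOpenImmersion j] : j ≫ (η.app Y).hom.left = j := by
  have : LocallyOfFiniteType Y.obj.hom := Y.property.1
  let f : Spec R ⟶ Spec (CommRingCat.of ℚ) := j ≫ Y.obj.hom
  have : LocallyOfFiniteType f :=
    MorphismProperty.comp_mem _ _ _ (inferInstance : LocallyOfFiniteType j) this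
  let ι : ofSpec f ⟶ Y := ObjectProperty.homMk (Over.homMk j rfl)
  have h : j ≫ (η.app Y).hom.left = (η.app (ofSpec f)).hom.left ≫ j :=
    congr_arg (fun h => h.hom.left) (η.naturality ι)
  rw [app_ofSpec] at h
  exact h.trans (Category.id_comp _)

end SchQ

theorem mainTheorem5 (η : 𝟭 SchQ ⟶ 𝟭 SchQ) : η = 𝟙 (𝟭 SchQ) := by
  ext Y : 2
  apply ObjectProperty.hom_ext
  apply Over.OverMorphism.ext
  refine Scheme.Cover.hom_ext Y.obj.left.affineCover _ _ fun i => ?_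
  exact (@SchQ.comp_app_of_isOpenImmersion η Y _ (Y.obj.left.affineCover.f i)
    (Y.obj.left.affineCover.map_prop i)).trans (Category.comp_id _).symm
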